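/- Let $H$ be a complex Hilbert space of finite dimension $d\ge 1$ with orthonormal basis $e_1,\dots,e_d$, and let $U$ be a unitary operator on $H$. Let $X_i=|e_i\rangle\langle e_i|$ and $Y_i=UX_iU^\dagger$ be the elements of the two corresponding projective measurements, and write $U$ also for the matrix $U_{ij}=\langle e_i|Ue_j\rangle$ of $U$ in the basis $(e_i)$. For a state $\rho$ (a positive operator on $H$ with trace one) let $H(X|\rho)=-\sum_i \operatorname{tr}(\rho X_i)\log\operatorname{tr}(\rho X_i)$ and $H(Y|\rho)=-\sum_i \operatorname{tr}(\rho Y_i)\log\operatorname{tr}(\rho Y_i)$ be the Shannon entropies of the outcome distributions, with $0\log 0=0$. For real $\lambda,\mu\ge 0$ let $$c(\lambda,\mu)=\inf_\rho\ \bigl(\lambda H(X|\rho)+\mu H(Y|\rho)\bigr),$$ the infimum being over all states. For $0<p<\infty$ and $x\in\mathbb{C}^d$ put $\|x\|_p=(\sum_i|x_i|^p)^{1/p}$, put $\|x\|_\infty=\max_i|x_i|$, and let $B_p=\{x\in\mathbb{C}^d:\|x\|_p\le 1\}$. For real $N\ge 1$ put $$\omega_N(\lambda,\mu)=\sup_{x\in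 B_r,\ y\in B_s}\bigl|x^\dagger U y\bigr|,\qquad r=\frac{2N}{N+2\lambda},\quad s=\frac{2N}{N+2\mu}.$$ Then the following hold. (i) For every real $N\ge 1$, $\;c(\lambda,\mu)\ge -N\log\omega_N(\lambda,\mu)$. (ii) For every real $N\ge1$ with $\lambda\le N/2$ and $\mu\le N/2$, $$\omega_N(\lambda,\mu)=\sup_{0\ne\phi\in\mathbb{C}^d}\frac{\|U\phi\|_{r'}}{\|\phi\|_s}=\sup_{0\ne\phi\in\mathbb{C}^d}\frac{\|U^\dagger\phi\|_{s'}}{\|\phi\|_r},\qquad r'=\frac{2N}{N-2\lambda},\quad s'=\frac{2N}{N-2\mu},$$ where $r'=\infty$ if $\lambda=N/2$ and $s'=\infty$ if $\mu=N/2$. (iii) If $\lambda,\mu>0$, then $\;c(\lambda,\mu)=\lim_{N\to\infty}-N\log\omega_N(\lambda,\mu)$, the limit being over real $N$. -/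

import Mathlib

namespace EntropicUncertainty

noncomputable section

variable {d : ℕ} {H : Type*} [NormedAddCommGroup H] [InnerProductSpace ℂ H]

/-- A quantum state: a positive operator of trace one. -/
def IsState (ρ : H →ₗ[ℂ] H) : Prop :=
  ρ.IsPositive ∧ LinearMap.trace ℂ H ρ = 1

/-- The elements `X i = |e i⟩⟨e i|` of the non-degenerate projective measurement in the
orthonormal basis `e`. -/
def measX (e : OrthonormalBasis (Fin d) ℂ H) (i : Fin d) : H →ₗ[ℂ] H :=
  (InnerProductSpace.rankOne ℂ (e i) (e i)).toLinearMap

/-- The elements `Y i = U (X i) U†` of the second measurement (`U† = U⁻¹` as `U` is unitary). -/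
def measY (e : OrthonormalBasis (Fin d) ℂ H) (U : H ≃ₗᵢ[ℂ] H) (i : Fin d) : H →ₗ[ℂ] H :=
  U.toLinearEquiv.toLinearMap ∘ₗ measX e i ∘ₗ U.symm.toLinearEquiv.toLinearMap

/-- The probability `tr (ρ P i)` of the `i`-th outcome of the measurement `P` in the state `ρ`. -/
def outcomeProb (P : Fin d → H →ₗ[ℂ] H) (ρ : H →ₗ[ℂ] H) (i : Fin d) : ℝ :=
  (LinearMap.trace ℂ H (ρ ∘ₗ P i)).re

/-- The Shannon entropy `H(P|ρ)` of the outcome distribution (with `0 log 0 = 0`). -/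
def shannonEntropy (P : Fin d → H →ₗ[ℂ] H) (ρ : H →ₗ[ℂ] H) : ℝ :=
  -∑ i, outcomeProb P ρ i * Real.log (outcomeProb P ρ i)

/-- The optimal constant `c(λ, μ) = inf_ρ (λ H(X|ρ) + μ H(Y|ρ))`. -/
def optConst (e : OrthonormalBasis (Fin d) ℂ H) (U : H ≃ₗᵢ[ℂ] H) (lam mu : ℝ) : ℝ :=
  sInf {t : ℝ | ∃ ρ : H →ₗ[ℂ] H, IsState ρ ∧
    t = lam * shannonEntropy (measX e) ρ + mu * shannonEntropy (measY e U) ρ}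

/-- The matrix of `U` in the basis `e`, with entries `⟨e i, U (e j)⟩`. -/
def basisMatrix (e : OrthonormalBasis (Fin d) ℂ H) (U : H ≃ₗᵢ[ℂ] H) : Matrix (Fin d) (Fin d) ℂ :=
  LinearMap.toMatrix e.toBasis e.toBasis U.toLinearEquiv.toLinearMap

/-- The `p`-norm `(∑ |x i| ^ p) ^ (1 / p)` on `ℂ ^ d` for `0 < p < ∞` (a quasi-norm if `p < 1`),
and `max |x i|` for `p = ∞`. -/
def pNorm (p : ENNReal) (x : Fin d → ℂ) : ℝ :=
  ‖(WithLp.toLp p x : PiLp p fun _ : Fin d => ℂ)‖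

/-- The closed unit ball of the `p`-norm. -/
def pBall (d : ℕ) (p : ENNReal) : Set (Fin d → ℂ) := {x | pNorm p x ≤ 1}

/-- The exponent `2N / (N + 2λ)`. -/
def ballExp (N lam : ℝ) : ENNReal := ENNReal.ofReal (2 * N / (N + 2 * lam))

/-- The exponent `2N / (N - 2λ)` for `λ ≤ N / 2`, which is `∞` for `λ = N / 2`. -/
def dualExp (N lam : ℝ) : ENNReal := ENNReal.ofReal (2 * N) / ENNReal.ofReal (N - 2 * lam)

/-- The numbers `|x† M y|` for `x` in the unit `r`-ball and `y` in the unit `s`-ball. -/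
def omegaSet (M : Matrix (Fin d) (Fin d) ℂ) (r s : ENNReal) : Set ℝ :=
  {t : ℝ | ∃ x ∈ pBall d r, ∃ y ∈ pBall d s, t = ‖star x ⬝ᵥ M.mulVec y‖}

/-- `ω_N(λ, μ)`, the supremum of `|x† M y|` over the two unit balls. -/
def omega (M : Matrix (Fin d) (Fin d) ℂ) (N lam mu : ℝ) : ℝ :=
  sSup (omegaSet M (ballExp N lam) (ballExp N mu))

/-- The operator norm of `M` from the `p`-norm to the `q`-norm. -/
def opNorm (M : Matrix (Fin d) (Fin d) ℂ) (p q : ENNReal) : ℝ :=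
  sSup {t : ℝ | ∃ φ : Fin d → ℂ, φ ≠ 0 ∧ t = pNorm q (M.mulVec φ) / pNorm p φ}

end

/-- Entries of a vector in a unit ball have modulus at most one. -/
lemma norm_le_one_of_mem_pBall {d : ℕ} {p : ENNReal} (hp : 0 < p.toReal) {x : Fin d → ℂ}
    (hx : x ∈ pBall d p) (i : Fin d) : ‖x i‖ ≤ 1 := by
  have h1 : (∑ j, ‖x j‖ ^ p.toReal) ^ (1 / p.toReal) ≤ 1 := by
    have h := PiLp.norm_eq_sum hp (WithLp.toLp p x : PiLp p fun _ : Fin d => ℂ)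
    have h' : pNorm p x ≤ 1 := hx
    rw [pNorm, h] at h'
    exact h'
  have hnn : 0 ≤ ∑ j, ‖x j‖ ^ p.toReal :=
    Finset.sum_nonneg fun j _ => Real.rpow_nonneg (norm_nonneg _) _
  have h2 : ∑ j, ‖x j‖ ^ p.toReal ≤ 1 := by
    by_contra! hc
    exact absurd h1 (not_le.mpr (Real.one_lt_rpow hc (by positivity)))
  have h3 : ‖x i‖ ^ p.toReal ≤ ∑ j, ‖x j‖ ^ p.toReal :=
    Finset.single_le_sum (f := fun j => ‖x j‖ ^ p.toReal)
      (fun j _ => Real.rpow_nonneg (norm_nonneg _) _) (Finset.mem_univ i)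
  by_contra! hc
  exact absurd (h3.trans h2) (not_le.mpr (Real.one_lt_rpow hc hp))

/-- The supremum that defines `omega` is that of a bounded set. -/
lemma bddAbove_omegaSet {d : ℕ} (M : Matrix (Fin d) (Fin d) ℂ) {N lam mu : ℝ} (hN : 0 < N)
    (hlam : 0 ≤ lam) (hmu : 0 ≤ mu) : BddAbove (omegaSet M (ballExp N lam) (ballExp N mu)) := by
  have hexp : ∀ a : ℝ, 0 ≤ a → 0 < (ballExp N a).toReal := fun a ha => by
    have : 0 < 2 * N / (N + 2 * a) := by positivity
    rw [ballExp, ENNReal.toReal_ofReal this.le]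
    exact this
  refine ⟨∑ i, ∑ j, ‖M i j‖, ?_⟩
  rintro t ⟨x, hx, y, hy, rfl⟩
  simp only [dotProduct, Matrix.mulVec]
  refine (norm_sum_le _ _).trans (Finset.sum_le_sum fun i _ => ?_)
  have hxi := norm_le_one_of_mem_pBall (hexp lam hlam) hx i
  rw [norm_mul, Pi.star_apply, norm_star]
  refine (mul_le_of_le_one_left (norm_nonneg _) hxi).trans ?_
  refine (norm_sum_le _ _).trans (Finset.sum_le_sum fun j _ => ?_)
  have hyj := norm_le_one_of_mem_pBall (hexp mu hmu) hy j
  rw [norm_mul]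
  exact mul_le_of_le_one_right (norm_nonneg _) hyj

end EntropicUncertainty

namespace EntropicUncertainty

/-! By concavity of entropy and the spectral theorem, only pure states matter. If `b` is the
coordinate vector of a unit vector in the basis `U e_j` and `M` is the matrix of `U`, then `a = M b`
is its coordinate vector in `e`, and the quantity to minimize is `λ H(|a|²) + μ H(|b|²)`.

Lower bound (i), by complex interpolation: let `F(z) = x(z)† M y(z)`, where the entries of `x(z)`,
`y(z)` have modulus `|a|^(1 + (2λ/N) Re z)`, `|b|^(1 + (2μ/N) Re z)`. Cauchy-Schwarz gives `|F| ≤ 1`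
on `Re z = 0`; on `Re z = 1` the vectors lie in the two balls, so `|F| ≤ ω`. The three lines theorem
yields `|F(s)| ≤ ω^s` (`norm_rieszFamily_le_rpow`). Since `F(0) = 1`, comparing derivatives at `0`
gives `-(λ H(|a|²) + μ H(|b|²)) / N ≤ log ω` (`neg_mul_log_omega_le_vec`).

Norm formulas (ii): Hölder duality in `x`, with equality attained, and passage to the adjoint.

Limit (iii): write near-maximizers as `x = a|a|^(2λ/N)`, `y = b|b|^(2μ/N)` with `a`, `b` in the
Euclidean unit ball. Cauchy-Schwarz and a second-order expansion bound the form by `exp(-(λ H(|a|²)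
+ μ H(|b|²)) / N + O(1/N²))` (`norm_form_le_exp`). At a limit point as `N → ∞` the form has modulus
at least `1`, which forces `a = z M b` with `|z| = 1`, so `b` is a unit vector with the required
weighted entropy (`exists_vec_of_frequently_le`). -/

/-! ### Entropy of coordinate vectors and unitary forms -/

/-- The Shannon entropy of the distribution `|a i| ^ 2`. -/
noncomputable def vecEntropy {d : ℕ} (a : Fin d → ℂ) : ℝ := ∑ i, Real.negMulLog (‖a i‖ ^ 2)

lemma norm_sq_le_one_of_sum_le_one {d : ℕ} {a : Fin d → ℂ} (ha : ∑ i, ‖a i‖ ^ 2 ≤ 1) (i : Fin d) :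
    ‖a i‖ ^ 2 ≤ 1 :=
  (Finset.single_le_sum (f := fun j => ‖a j‖ ^ 2) (fun _ _ => sq_nonneg _)
    (Finset.mem_univ i)).trans ha

lemma vecEntropy_nonneg {d : ℕ} {a : Fin d → ℂ} (ha : ∑ i, ‖a i‖ ^ 2 ≤ 1) : 0 ≤ vecEntropy a :=
  Finset.sum_nonneg fun i _ =>
    Real.negMulLog_nonneg (sq_nonneg _) (norm_sq_le_one_of_sum_le_one ha i)

lemma continuous_vecEntropy {d : ℕ} : Continuous (vecEntropy (d := d)) := by
  unfold vecEntropy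
  fun_prop

lemma vecEntropy_smul {d : ℕ} {z : ℂ} (hz : ‖z‖ = 1) (a : Fin d → ℂ) :
    vecEntropy (z • a) = vecEntropy a := by
  simp [vecEntropy, hz]

lemma star_dotProduct_self_eq {d : ℕ} (x : Fin d → ℂ) :
    star x ⬝ᵥ x = ((∑ i, ‖x i‖ ^ 2 : ℝ) : ℂ) := by
  simp [dotProduct, Complex.conj_mul']

lemma sum_norm_sq_mulVec {d : ℕ} {M : Matrix (Fin d) (Fin d) ℂ}
    (hM : M ∈ Matrix.unitaryGroup (Fin d) ℂ) (b : Fin d → ℂ) :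
    ∑ i, ‖M.mulVec b i‖ ^ 2 = ∑ j, ‖b j‖ ^ 2 := by
  have h : star (M.mulVec b) ⬝ᵥ M.mulVec b = star b ⬝ᵥ b := by
    rw [Matrix.star_mulVec, ← Matrix.dotProduct_mulVec, Matrix.mulVec_mulVec,
      ← Matrix.star_eq_conjTranspose, Matrix.mem_unitaryGroup_iff'.mp hM, Matrix.one_mulVec]
  rw [star_dotProduct_self_eq, star_dotProduct_self_eq] at h
  exact_mod_cast h

/-- The Cauchy-Schwarz inequality for the form `x† M y` of a unitary matrix `M`. -/
lemma norm_form_le_sqrt_mul_sqrt {d : ℕ} {M : Matrix (Fin d) (Fin d) ℂ}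
    (hM : M ∈ Matrix.unitaryGroup (Fin d) ℂ) (x y : Fin d → ℂ) :
    ‖star x ⬝ᵥ M.mulVec y‖ ≤ √(∑ i, ‖x i‖ ^ 2) * √(∑ i, ‖y i‖ ^ 2) := by
  rw [← sum_norm_sq_mulVec hM y]
  have h := norm_inner_le_norm (𝕜 := ℂ) (WithLp.toLp 2 x : EuclideanSpace ℂ (Fin d))
    (WithLp.toLp 2 (M.mulVec y))
  rwa [EuclideanSpace.inner_toLp_toLp, EuclideanSpace.norm_eq, EuclideanSpace.norm_eq,
    dotProduct_comm] at h

/-! ### Reduction to pure states -/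

section States

variable {d : ℕ} {H : Type*} [NormedAddCommGroup H] [InnerProductSpace ℂ H]
  (e : OrthonormalBasis (Fin d) ℂ H) (U : H ≃ₗᵢ[ℂ] H)

/-- Lets every fact about the measurement in an arbitrary orthonormal basis serve for both
measurements. -/
lemma measY_eq_measX_map : measY e U = measX (e.map U) := by
  funext i
  ext v
  simp only [measY, measX, LinearMap.comp_apply]
  have : inner ℂ (e i) (U.symm v) = inner ℂ (U (e i)) v := by
    rw [← U.inner_map_map, U.apply_symm_apply]
  simp [this]

lemma outcomeProb_measX (ρ : H →ₗ[ℂ] H) (i : Fin d) :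
    outcomeProb (measX e) ρ i = (inner ℂ (e i) (ρ (e i))).re := by
  have := e.toBasis.finiteDimensional_of_finite
  have h : ρ ∘ₗ measX e i = (InnerProductSpace.rankOne ℂ (ρ (e i)) (e i)).toLinearMap := by
    ext v
    simp [measX]
  rw [outcomeProb, h, InnerProductSpace.trace_rankOne]

lemma shannonEntropy_eq_sum_negMulLog (P : Fin d → H →ₗ[ℂ] H) (ρ : H →ₗ[ℂ] H) :
    shannonEntropy P ρ = ∑ i, Real.negMulLog (outcomeProb P ρ i) := by
  simp [shannonEntropy, Real.negMulLog]

/-- The coordinates of `U⁻¹ ψ` are mapped by the matrix of `U` to those of `ψ`. -/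
lemma basisMatrix_mulVec_inner (ψ : H) :
    (basisMatrix e U).mulVec (fun j => inner ℂ (U (e j)) ψ) = fun i => inner ℂ (e i) ψ := by
  have h : (fun j => inner ℂ (U (e j)) ψ) = ⇑(e.toBasis.repr (U.symm ψ)) := by
    funext j
    rw [e.coe_toBasis_repr_apply, e.repr_apply_apply, ← U.inner_map_map (e j), U.apply_symm_apply]
  rw [h, basisMatrix, LinearMap.toMatrix_mulVec_repr]
  funext i
  simp [e.repr_apply_apply]

lemma basisMatrix_mem_unitaryGroup :
    basisMatrix e U ∈ Matrix.unitaryGroup (Fin d) ℂ :=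
  U.toMatrix_mem_unitaryGroup e e

lemma sum_norm_sq_inner (f : OrthonormalBasis (Fin d) ℂ H) {ψ : H} (hψ : ‖ψ‖ = 1) :
    ∑ i, ‖inner ℂ (f i) ψ‖ ^ 2 = 1 := by
  rw [f.sum_sq_norm_inner_right, hψ, one_pow]

/-- Concavity of the entropy: the entropy of a mixture is at least the average entropy of its
eigenvectors. -/
lemma sum_mul_vecEntropy_le_shannonEntropy {n : ℕ} (f : OrthonormalBasis (Fin d) ℂ H)
    {ρ : H →ₗ[ℂ] H} (v : OrthonormalBasis (Fin n) ℂ H) {w : Fin n → ℝ}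
    (hv : ∀ k, ρ (v k) = (w k : ℂ) • v k) (hw : ∀ k, 0 ≤ w k) (hw1 : ∑ k, w k = 1) :
    ∑ k, w k * vecEntropy (fun i => inner ℂ (f i) (v k)) ≤ shannonEntropy (measX f) ρ := by
  have hp : ∀ i, outcomeProb (measX f) ρ i = ∑ k, w k • ‖inner ℂ (f i) (v k)‖ ^ 2 := by
    intro i
    rw [outcomeProb_measX]
    -- Only the copy of `f i` under `ρ` is to be expanded in eigenvectors: this rewrite expands
    -- both, and the next one folds the left slot of the inner product back.
    conv_lhs => rw [← v.sum_repr' (f i)]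
    conv_lhs => enter [1, 2]; rw [v.sum_repr' (f i)]
    simp only [map_sum, map_smul, hv, inner_sum, inner_smul_right, Complex.re_sum]
    refine Finset.sum_congr rfl fun k _ => ?_
    rw [mul_left_comm, ← inner_conj_symm, ← Complex.normSq_eq_conj_mul_self, smul_eq_mul,
      ← Complex.ofReal_mul, Complex.ofReal_re, Complex.normSq_eq_norm_sq]
  rw [shannonEntropy_eq_sum_negMulLog]
  simp only [vecEntropy, Finset.mul_sum]
  rw [Finset.sum_comm]
  refine Finset.sum_le_sum fun i _ => ?_
  rw [hp i]
  exact Real.concaveOn_negMulLog.le_map_sum (fun k _ => hw k) hw1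
    (fun k _ => Set.mem_Ici.mpr (sq_nonneg _))

/-- Diagonalize `ρ`: the bound holds at each eigenvector, hence for their average with the
eigenvalues as weights, and concavity passes it to `ρ`. -/
lemma le_of_forall_vec {lam mu K : ℝ} (hlam : 0 ≤ lam) (hmu : 0 ≤ mu)
    (h : ∀ b : Fin d → ℂ, ∑ j, ‖b j‖ ^ 2 = 1 →
      K ≤ lam * vecEntropy ((basisMatrix e U).mulVec b) + mu * vecEntropy b)
    {ρ : H →ₗ[ℂ] H} (hρ : IsState ρ) :
    K ≤ lam * shannonEntropy (measX e) ρ + mu * shannonEntropy (measY e U) ρ := by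
  have := e.toBasis.finiteDimensional_of_finite
  have hs := hρ.1.isSymmetric
  set v := hs.eigenvectorBasis rfl
  set w := hs.eigenvalues rfl
  have hv : ∀ k, ρ (v k) = (w k : ℂ) • v k := fun k => hs.apply_eigenvectorBasis rfl k
  have hw : ∀ k, 0 ≤ w k := fun k => hρ.1.nonneg_eigenvalues rfl k
  have hw1 : ∑ k, w k = 1 := by
    rw [← hs.re_trace_eq_sum_eigenvalues, hρ.2]
    simp
  have hX := sum_mul_vecEntropy_le_shannonEntropy e v hv hw hw1
  have hY := sum_mul_vecEntropy_le_shannonEntropy (e.map U) v hv hw hw1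
  rw [measY_eq_measX_map]
  have hk : ∀ k, K ≤ lam * vecEntropy (fun i => inner ℂ (e i) (v k)) +
      mu * vecEntropy (fun i => inner ℂ (e.map U i) (v k)) := fun k => by
    have h1 := sum_norm_sq_inner (e.map U) (v.orthonormal.norm_eq_one k)
    have := h _ h1
    simp only [OrthonormalBasis.map_apply] at this ⊢
    rwa [basisMatrix_mulVec_inner] at this
  calc K = ∑ k, w k * K := by rw [← Finset.sum_mul, hw1, one_mul]
    _ ≤ ∑ k, w k * (lam * vecEntropy (fun i => inner ℂ (e i) (v k)) +
      mu * vecEntropy (fun i => inner ℂ (e.map U i) (v k))) :=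
        Finset.sum_le_sum fun k _ => mul_le_mul_of_nonneg_left (hk k) (hw k)
    _ = lam * (∑ k, w k * vecEntropy (fun i => inner ℂ (e i) (v k))) +
      mu * (∑ k, w k * vecEntropy (fun i => inner ℂ (e.map U i) (v k))) := by
        rw [Finset.mul_sum, Finset.mul_sum, ← Finset.sum_add_distrib]
        exact Finset.sum_congr rfl fun k _ => by ring
    _ ≤ _ := by gcongr

lemma isState_rankOne [FiniteDimensional ℂ H] {ψ : H} (hψ : ‖ψ‖ = 1) :
    IsState (InnerProductSpace.rankOne ℂ ψ ψ).toLinearMap := by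
  refine ⟨(InnerProductSpace.isPositive_rankOne_self ψ).toLinearMap, ?_⟩
  rw [InnerProductSpace.trace_rankOne, inner_self_eq_norm_sq_to_K, hψ]
  simp

lemma shannonEntropy_rankOne (f : OrthonormalBasis (Fin d) ℂ H) (ψ : H) :
    shannonEntropy (measX f) (InnerProductSpace.rankOne ℂ ψ ψ).toLinearMap =
      vecEntropy (fun i => inner ℂ (f i) ψ) := by
  rw [shannonEntropy_eq_sum_negMulLog, vecEntropy]
  refine Finset.sum_congr rfl fun i _ => ?_
  rw [outcomeProb_measX, ContinuousLinearMap.coe_coe, InnerProductSpace.rankOne_apply,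
    inner_smul_right, ← inner_conj_symm, ← Complex.normSq_eq_conj_mul_self, Complex.ofReal_re,
    Complex.normSq_eq_norm_sq]

lemma exists_state_of_vec (b : Fin d → ℂ) (hb : ∑ j, ‖b j‖ ^ 2 = 1) (lam mu : ℝ) :
    ∃ ρ : H →ₗ[ℂ] H, IsState ρ ∧
      lam * vecEntropy ((basisMatrix e U).mulVec b) + mu * vecEntropy b =
        lam * shannonEntropy (measX e) ρ + mu * shannonEntropy (measY e U) ρ := by
  have hbψ : ∀ j, inner ℂ (e.map U j) ((e.map U).repr.symm (WithLp.toLp 2 b)) = b j := fun j => by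
    rw [← (e.map U).repr_apply_apply, LinearIsometryEquiv.apply_symm_apply]
  set ψ := (e.map U).repr.symm (WithLp.toLp 2 b) with hψ
  have hψ1 : ‖ψ‖ = 1 := by
    rw [hψ, LinearIsometryEquiv.norm_map, EuclideanSpace.norm_eq]
    simp [hb]
  have := e.toBasis.finiteDimensional_of_finite
  refine ⟨_, isState_rankOne hψ1, ?_⟩
  rw [measY_eq_measX_map, shannonEntropy_rankOne, shannonEntropy_rankOne,
    ← basisMatrix_mulVec_inner e U]
  simp only [OrthonormalBasis.map_apply] at hbψ ⊢
  simp only [hbψ]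

lemma optConst_le {lam mu : ℝ} (hlam : 0 ≤ lam) (hmu : 0 ≤ mu)
    (b : Fin d → ℂ) (hb : ∑ j, ‖b j‖ ^ 2 = 1) :
    optConst e U lam mu ≤ lam * vecEntropy ((basisMatrix e U).mulVec b) + mu * vecEntropy b := by
  refine csInf_le ⟨0, ?_⟩ (exists_state_of_vec e U b hb lam mu)
  rintro t ⟨ρ, hρ, rfl⟩
  refine le_of_forall_vec e U hlam hmu (fun b hb => ?_) hρ
  have ha := (sum_norm_sq_mulVec (basisMatrix_mem_unitaryGroup e U) b).trans hb
  have := vecEntropy_nonneg ha.le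
  have := vecEntropy_nonneg hb.le
  positivity

lemma le_optConst (hd : 1 ≤ d) {lam mu K : ℝ} (hlam : 0 ≤ lam) (hmu : 0 ≤ mu)
    (h : ∀ b : Fin d → ℂ, ∑ j, ‖b j‖ ^ 2 = 1 →
      K ≤ lam * vecEntropy ((basisMatrix e U).mulVec b) + mu * vecEntropy b) :
    K ≤ optConst e U lam mu := by
  -- A unit vector exists because `d ≥ 1`, so the infimum is over a nonempty set.
  have hb : ∑ j, ‖(Pi.single ⟨0, hd⟩ 1 : Fin d → ℂ) j‖ ^ 2 = 1 := by
    rw [Finset.sum_eq_single ⟨0, hd⟩] <;> simp +contextual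
  refine le_csInf ⟨_, exists_state_of_vec e U _ hb lam mu⟩ ?_
  rintro t ⟨ρ, hρ, rfl⟩
  exact le_of_forall_vec e U hlam hmu h hρ

end States

/-! ### Unit balls with real exponents -/

lemma pNorm_ofReal {d : ℕ} {p : ℝ} (hp : 0 < p) (x : Fin d → ℂ) :
    pNorm (ENNReal.ofReal p) x = (∑ i, ‖x i‖ ^ p) ^ (1 / p) := by
  have h : (ENNReal.ofReal p).toReal = p := ENNReal.toReal_ofReal hp.le
  rw [pNorm, PiLp.norm_eq_sum (by rwa [h]), h]

lemma mem_pBall_ofReal_iff {d : ℕ} {p : ℝ} (hp : 0 < p) {x : Fin d → ℂ} :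
    x ∈ pBall d (ENNReal.ofReal p) ↔ ∑ i, ‖x i‖ ^ p ≤ 1 := by
  have h0 : 0 ≤ ∑ i, ‖x i‖ ^ p := Finset.sum_nonneg fun _ _ => by positivity
  change pNorm _ x ≤ 1 ↔ _
  rw [pNorm_ofReal hp]
  have h := Real.rpow_le_rpow_iff h0 zero_le_one (one_div_pos.mpr hp)
  rwa [Real.one_rpow] at h

lemma ballExp_pos {N a : ℝ} (hN : 0 < N) (ha : 0 ≤ a) : 0 < 2 * N / (N + 2 * a) := by
  positivity

/-- The exponents satisfy `(1 + 2λ/N) r = 2`, so `a ↦ a|a|^(2λ/N)` carries the Euclidean ball into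
the `r`-ball. -/
lemma mem_pBall_ballExp {d : ℕ} {N lam : ℝ} (hN : 0 < N) (hlam : 0 ≤ lam) {a x : Fin d → ℂ}
    (ha : ∑ i, ‖a i‖ ^ 2 ≤ 1) (hx : ∀ i, ‖x i‖ = ‖a i‖ ^ (1 + 2 * lam / N)) :
    x ∈ pBall d (ballExp N lam) := by
  rw [ballExp, mem_pBall_ofReal_iff (ballExp_pos hN hlam)]
  refine le_trans (le_of_eq (Finset.sum_congr rfl fun i _ => ?_)) ha
  have : (1 + 2 * lam / N) * (2 * N / (N + 2 * lam)) = 2 := by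
    have : N + 2 * lam ≠ 0 := by positivity
    field_simp
  rw [hx, ← Real.rpow_mul (norm_nonneg _), this, Real.rpow_two]

lemma norm_form_le_omega {d : ℕ} (M : Matrix (Fin d) (Fin d) ℂ) {N lam mu : ℝ} (hN : 0 < N)
    (hlam : 0 ≤ lam) (hmu : 0 ≤ mu) {x y : Fin d → ℂ} (hx : x ∈ pBall d (ballExp N lam))
    (hy : y ∈ pBall d (ballExp N mu)) : ‖star x ⬝ᵥ M.mulVec y‖ ≤ omega M N lam mu :=
  le_csSup (bddAbove_omegaSet M hN hlam hmu) ⟨x, hx, y, hy, rfl⟩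

/-! ### Complex interpolation and the lower bound -/

lemma norm_mul_exp_log {t : ℝ} (u z : ℂ) :
    ‖u * Complex.exp ((t * Real.log ‖u‖ : ℝ) * z)‖ = ‖u‖ * Real.exp (t * Real.log ‖u‖ * z.re) := by
  rw [norm_mul, Complex.norm_exp, Complex.re_ofReal_mul]

lemma norm_mul_exp_log_le {t : ℝ} (ht : 0 ≤ t) {u z : ℂ} (hu : ‖u‖ ≤ 1) (hz : 0 ≤ z.re) :
    ‖u * Complex.exp ((t * Real.log ‖u‖ : ℝ) * z)‖ ≤ ‖u‖ := by
  rw [norm_mul_exp_log]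
  refine mul_le_of_le_one_right (norm_nonneg _) (Real.exp_le_one_iff.mpr ?_)
  exact mul_nonpos_of_nonpos_of_nonneg
    (mul_nonpos_of_nonneg_of_nonpos ht (Real.log_nonpos (norm_nonneg _) hu)) hz

lemma norm_mul_exp_log_eq_rpow {t : ℝ} (ht : 0 ≤ t) {u z : ℂ} (hz : z.re = 1) :
    ‖u * Complex.exp ((t * Real.log ‖u‖ : ℝ) * z)‖ = ‖u‖ ^ (1 + t) := by
  rw [norm_mul_exp_log, hz, mul_one]
  rcases (norm_nonneg u).eq_or_lt with h | h
  · rw [← h, zero_mul, Real.zero_rpow (by positivity)]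
  · rw [Real.rpow_add h, Real.rpow_one, Real.rpow_def_of_pos h, mul_comm t]

/-- The analytic family `z ↦ x(z)† M y(z)`, where `x(z)` and `y(z)` have entries `a |a| ^ (s conj z)` and
`b |b| ^ (t z)`. -/
noncomputable def rieszFamily {d : ℕ} (M : Matrix (Fin d) (Fin d) ℂ) (a b : Fin d → ℂ) (s t : ℝ)
    (z : ℂ) : ℂ :=
  ∑ i, (star (a i) * Complex.exp ((s * Real.log ‖star (a i)‖ : ℝ) * z)) *
    ∑ j, M i j * (b j * Complex.exp ((t * Real.log ‖b j‖ : ℝ) * z))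

lemma rieszFamily_eq_form {d : ℕ} (M : Matrix (Fin d) (Fin d) ℂ) (a b : Fin d → ℂ) (s t : ℝ)
    (z : ℂ) : rieszFamily M a b s t z =
      star (star fun i => star (a i) * Complex.exp ((s * Real.log ‖star (a i)‖ : ℝ) * z)) ⬝ᵥ
        M.mulVec fun j => b j * Complex.exp ((t * Real.log ‖b j‖ : ℝ) * z) := by
  rw [star_star]
  rfl

lemma differentiable_rieszFamily {d : ℕ} (M : Matrix (Fin d) (Fin d) ℂ) (a b : Fin d → ℂ)
    (s t : ℝ) : Differentiable ℂ (rieszFamily M a b s t) := by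
  unfold rieszFamily
  fun_prop

lemma norm_sq_mul_log (u : ℂ) (t : ℝ) :
    ‖u‖ ^ 2 * (t * Real.log ‖u‖) = -(t / 2) * Real.negMulLog (‖u‖ ^ 2) := by
  rw [Real.negMulLog, Real.log_pow]
  push_cast
  ring

/-- The product rule gives two sums, one for each factor. Unitarity collapses them through `M b = a`
and `a† M = b†` to `∑ |a|² log |a|` and `∑ |b|² log |b|`, which are `-1/2` times the entropies. -/
lemma hasDerivAt_rieszFamily_zero {d : ℕ} {M : Matrix (Fin d) (Fin d) ℂ}
    (hM : M ∈ Matrix.unitaryGroup (Fin d) ℂ) (b : Fin d → ℂ) (s t : ℝ) :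
    HasDerivAt (rieszFamily M (M.mulVec b) b s t)
      ((-(s / 2 * vecEntropy (M.mulVec b) + t / 2 * vecEntropy b) : ℝ) : ℂ) 0 := by
  set a := M.mulVec b with ha
  have hexp : ∀ c : ℂ, HasDerivAt (fun z : ℂ => Complex.exp (c * z)) c 0 := fun c => by
    simpa using ((hasDerivAt_id (0 : ℂ)).const_mul c).cexp
  have h := HasDerivAt.fun_sum (u := Finset.univ) fun i (_ : i ∈ Finset.univ) =>
    ((hexp (s * Real.log ‖star (a i)‖ : ℝ)).const_mul (star (a i))).mul
      (HasDerivAt.fun_sum (u := Finset.univ) fun j (_ : j ∈ Finset.univ) =>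
        (((hexp (t * Real.log ‖b j‖ : ℝ)).const_mul (b j)).const_mul (M i j)))
  refine h.congr_deriv ?_
  have hMb : ∀ i, ∑ j, M i j * b j = a i := fun i => rfl
  have hMa : ∀ j, ∑ i, star (a i) * M i j = star (b j) := fun j => by
    have h1 : Matrix.vecMul (star a) M = star b := by
      rw [ha, Matrix.star_mulVec, Matrix.vecMul_vecMul, ← Matrix.star_eq_conjTranspose,
        Matrix.mem_unitaryGroup_iff'.mp hM, Matrix.vecMul_one]
    exact congrFun h1 j
  have hsq : ∀ u : ℂ, star u * u = ((‖u‖ ^ 2 : ℝ) : ℂ) := fun u => by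
    simp [Complex.conj_mul']
  simp only [mul_zero, Complex.exp_zero, mul_one, hMb, Finset.sum_add_distrib, norm_star]
  have e1 : ∑ i, star (a i) * ((s * Real.log ‖a i‖ : ℝ) : ℂ) * a i =
      ((-(s / 2 * vecEntropy a) : ℝ) : ℂ) := by
    rw [vecEntropy, Finset.mul_sum, ← Finset.sum_neg_distrib, Complex.ofReal_sum]
    refine Finset.sum_congr rfl fun i _ => ?_
    rw [mul_right_comm, hsq, ← Complex.ofReal_mul, norm_sq_mul_log, neg_mul]
  have e2 : ∑ i, star (a i) * ∑ j, M i j * (b j * ((t * Real.log ‖b j‖ : ℝ) : ℂ)) =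
      ((-(t / 2 * vecEntropy b) : ℝ) : ℂ) := by
    simp only [Finset.mul_sum]
    rw [Finset.sum_comm, vecEntropy, Finset.mul_sum, ← Finset.sum_neg_distrib, Complex.ofReal_sum]
    refine Finset.sum_congr rfl fun j _ => ?_
    simp only [← mul_assoc]
    rw [← Finset.sum_mul, ← Finset.sum_mul, hMa, hsq, ← Complex.ofReal_mul, norm_sq_mul_log,
      neg_mul]
  rw [e1, e2, ← Complex.ofReal_add]
  congr 1
  ring

/-- A function that is at least its value at `0` on `[0, 1]` has nonnegative derivative at `0`. -/
lemma hasDerivAt_zero_nonneg {φ : ℝ → ℝ} {φ' : ℝ} (h : HasDerivAt φ φ' 0)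
    (hφ : ∀ s ∈ Set.Icc (0 : ℝ) 1, φ 0 ≤ φ s) : 0 ≤ φ' := by
  have ht := h.tendsto_slope_zero_right
  refine ge_of_tendsto ht ?_
  filter_upwards [Ioo_mem_nhdsGT (zero_lt_one (α := ℝ))] with s hs
  have := hφ s ⟨hs.1.le, hs.2.le⟩
  have h1 := hs.1
  rw [zero_add, smul_eq_mul]
  exact mul_nonneg (by positivity) (by linarith)

lemma omega_nonneg {d : ℕ} (M : Matrix (Fin d) (Fin d) ℂ) (N lam mu : ℝ) :
    0 ≤ omega M N lam mu :=
  Real.sSup_nonneg fun _ ⟨_, _, _, _, ht⟩ => ht ▸ norm_nonneg _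

lemma norm_rieszFamily_le_rpow {d : ℕ} {M : Matrix (Fin d) (Fin d) ℂ}
    (hM : M ∈ Matrix.unitaryGroup (Fin d) ℂ) {N lam mu : ℝ} (hN : 0 < N)
    (hlam : 0 ≤ lam) (hmu : 0 ≤ mu) {a b : Fin d → ℂ} (ha : ∑ i, ‖a i‖ ^ 2 ≤ 1)
    (hb : ∑ i, ‖b i‖ ^ 2 ≤ 1) {s : ℝ} (hs : s ∈ Set.Icc (0 : ℝ) 1) :
    ‖rieszFamily M a b (2 * lam / N) (2 * mu / N) s‖ ≤ omega M N lam mu ^ s := by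
  have hsl : 0 ≤ 2 * lam / N := by positivity
  have hsm : 0 ≤ 2 * mu / N := by positivity
  have hle : ∀ {c : Fin d → ℂ}, ∑ i, ‖c i‖ ^ 2 ≤ 1 → ∀ i, ‖c i‖ ≤ 1 := fun hc i =>
    (sq_le_one_iff₀ (norm_nonneg _)).mp (norm_sq_le_one_of_sum_le_one hc i)
  -- In the right half-plane the entries only shrink in modulus, so Cauchy-Schwarz suffices.
  have hone : ∀ z : ℂ, 0 ≤ z.re → ‖rieszFamily M a b (2 * lam / N) (2 * mu / N) z‖ ≤ 1 := by
    intro z hz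
    rw [rieszFamily_eq_form]
    refine (norm_form_le_sqrt_mul_sqrt hM _ _).trans ?_
    refine mul_le_one₀ (Real.sqrt_le_one.mpr ?_) (Real.sqrt_nonneg _) (Real.sqrt_le_one.mpr ?_)
    · refine (Finset.sum_le_sum fun i _ => ?_).trans ha
      rw [Pi.star_apply, norm_star]
      gcongr
      rw [← norm_star (a i)]
      exact norm_mul_exp_log_le hsl (by rw [norm_star]; exact hle ha i) hz
    · refine (Finset.sum_le_sum fun i _ => ?_).trans hb
      gcongr
      exact norm_mul_exp_log_le hsm (hle hb i) hz
  have h := Complex.HadamardThreeLines.norm_le_interp_of_mem_verticalClosedStrip₀₁'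
    (rieszFamily M a b (2 * lam / N) (2 * mu / N)) (z := s) (a := 1) (b := omega M N lam mu)
    (by simpa [Complex.HadamardThreeLines.verticalClosedStrip] using hs)
    (differentiable_rieszFamily M a b _ _).diffContOnCl
    ⟨1, by rintro _ ⟨z, hz, rfl⟩; exact hone z hz.1⟩
    (fun z hz => hone z (le_of_eq (Eq.symm hz))) (fun z hz => ?_)
  · simpa using h
  · rw [rieszFamily_eq_form]
    refine norm_form_le_omega M hN hlam hmu (mem_pBall_ballExp hN hlam ha fun i => ?_)
      (mem_pBall_ballExp hN hmu hb fun i => norm_mul_exp_log_eq_rpow hsm hz)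
    rw [Pi.star_apply, norm_star, norm_mul_exp_log_eq_rpow hsl hz, norm_star]

lemma rieszFamily_zero {d : ℕ} {M : Matrix (Fin d) (Fin d) ℂ}
    (hM : M ∈ Matrix.unitaryGroup (Fin d) ℂ) {b : Fin d → ℂ} (hb : ∑ i, ‖b i‖ ^ 2 = 1) (s t : ℝ) :
    rieszFamily M (M.mulVec b) b s t 0 = 1 := by
  have h : rieszFamily M (M.mulVec b) b s t 0 = star (M.mulVec b) ⬝ᵥ M.mulVec b := by
    simp [rieszFamily, dotProduct, Matrix.mulVec]
  rw [h, star_dotProduct_self_eq, sum_norm_sq_mulVec hM, hb, Complex.ofReal_one]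

/-- Basis vectors lie in both balls, so `ω` dominates every entry of `M`; if it vanished, so would
the unitary `M`. -/
lemma omega_pos {d : ℕ} (hd : 1 ≤ d) {M : Matrix (Fin d) (Fin d) ℂ}
    (hM : M ∈ Matrix.unitaryGroup (Fin d) ℂ) {N lam mu : ℝ} (hN : 0 < N)
    (hlam : 0 ≤ lam) (hmu : 0 ≤ mu) : 0 < omega M N lam mu := by
  have hball : ∀ {c : ℝ}, 0 ≤ c → ∀ i : Fin d,
      (Pi.single i 1 : Fin d → ℂ) ∈ pBall d (ballExp N c) := fun hc i =>
    mem_pBall_ballExp (a := Pi.single i 1) hN hc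
      (by rw [Finset.sum_eq_single i] <;> simp +contextual) fun j => by
        rcases eq_or_ne j i with rfl | h
        · simp
        · rw [Pi.single_eq_of_ne h, norm_zero, Real.zero_rpow (by positivity)]
  refine (omega_nonneg M N lam mu).lt_of_ne fun h0 => ?_
  have hz : M = 0 := by
    ext i j
    have h := norm_form_le_omega M hN hlam hmu (hball hlam i) (hball hmu j)
    rw [← h0, norm_le_zero_iff, Pi.star_single, star_one, single_one_dotProduct,
      Matrix.mulVec_single_one] at h
    exact h
  have h1 := Matrix.mem_unitaryGroup_iff'.mp hM
  rw [hz, mul_zero] at h1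
  simpa using congrFun (congrFun h1 ⟨0, hd⟩) ⟨0, hd⟩

lemma neg_mul_log_omega_le_vec {d : ℕ} (hd : 1 ≤ d) {M : Matrix (Fin d) (Fin d) ℂ}
    (hM : M ∈ Matrix.unitaryGroup (Fin d) ℂ) {N lam mu : ℝ} (hN : 0 < N)
    (hlam : 0 ≤ lam) (hmu : 0 ≤ mu) {b : Fin d → ℂ} (hb : ∑ i, ‖b i‖ ^ 2 = 1) :
    -N * Real.log (omega M N lam mu) ≤
      lam * vecEntropy (M.mulVec b) + mu * vecEntropy b := by
  have hω := omega_pos hd hM hN hlam hmu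
  set ω := omega M N lam mu
  have hder := (hasDerivAt_rieszFamily_zero hM b (2 * lam / N) (2 * mu / N))
  rw [← Complex.ofReal_zero] at hder
  have hre := hder.real_of_complex
  rw [Complex.ofReal_re] at hre
  have hpow : HasDerivAt (fun s : ℝ => ω ^ s) (Real.log ω) 0 := by
    simpa using Real.hasStrictDerivAt_const_rpow hω 0 |>.hasDerivAt
  -- `ω^s - Re F(s)` vanishes at `0` and is nonnegative on `[0, 1]`.
  have h := hasDerivAt_zero_nonneg (hpow.sub hre) fun s hs => ?_
  · have : 2 * lam / N / 2 * vecEntropy (M.mulVec b) + 2 * mu / N / 2 * vecEntropy b =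
        (lam * vecEntropy (M.mulVec b) + mu * vecEntropy b) / N := by
      field_simp
    rw [this, sub_neg_eq_add] at h
    have h2 := mul_nonneg hN.le h
    rw [mul_add, mul_div_cancel₀ _ hN.ne'] at h2
    linarith
  · simp only [Pi.sub_apply, Complex.ofReal_zero, Real.rpow_zero, rieszFamily_zero hM hb,
      Complex.one_re, sub_self, sub_nonneg]
    exact (Complex.re_le_norm _).trans (norm_rieszFamily_le_rpow hM hN hlam hmu
      ((sum_norm_sq_mulVec hM b).trans hb).le hb.le hs)

/-! ### Hölder duality and the operator norms -/

lemma exists_phase (z : ℂ) : ∃ u : ℂ, ‖u‖ = 1 ∧ star u * z = (‖z‖ : ℂ) := by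
  refine ⟨Complex.exp (z.arg * Complex.I), Complex.norm_exp_ofReal_mul_I _, ?_⟩
  have h1 : star (Complex.exp (z.arg * Complex.I)) * Complex.exp (z.arg * Complex.I) = 1 := by
    rw [Complex.star_def, Complex.conj_mul', Complex.norm_exp_ofReal_mul_I]
    simp
  calc star (Complex.exp (z.arg * Complex.I)) * z
      = star (Complex.exp (z.arg * Complex.I)) * (‖z‖ * Complex.exp (z.arg * Complex.I)) := by
        rw [Complex.norm_mul_exp_arg_mul_I]
    _ = ‖z‖ := by rw [mul_left_comm, h1, mul_one]

lemma dualExp_of_lt {N lam : ℝ} (h : lam < N / 2) :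
    dualExp N lam = ENNReal.ofReal (2 * N / (N - 2 * lam)) := by
  rw [dualExp, ENNReal.ofReal_div_of_pos (by linarith)]

lemma dualExp_half {N : ℝ} (hN : 0 < N) : dualExp N (N / 2) = ⊤ := by
  rw [dualExp, mul_div_cancel₀ N two_ne_zero, sub_self, ENNReal.ofReal_zero,
    ENNReal.div_zero]
  simpa using hN

lemma ballExp_half {N : ℝ} (hN : 0 < N) : ballExp N (N / 2) = ENNReal.ofReal 1 := by
  rw [ballExp]
  congr 1
  field_simp
  ring

lemma holderConjugate_dualExp {N lam : ℝ} (hN : 0 < N) (hlam : 0 ≤ lam) (h : lam < N / 2) :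
    (2 * N / (N - 2 * lam)).HolderConjugate (2 * N / (N + 2 * lam)) := by
  have h1 : 0 < N - 2 * lam := by linarith
  rw [Real.holderConjugate_iff]
  constructor
  · rw [one_lt_div h1]
    linarith
  · have : 0 < N + 2 * lam := by positivity
    field_simp
    ring

lemma norm_star_dotProduct_le_sum {d : ℕ} (x z : Fin d → ℂ) :
    ‖star x ⬝ᵥ z‖ ≤ ∑ i, ‖z i‖ * ‖x i‖ := by
  refine (norm_sum_le _ _).trans (le_of_eq (Finset.sum_congr rfl fun i _ => ?_))
  rw [norm_mul, Pi.star_apply, norm_star, mul_comm]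

/-- Hölder's inequality for the exponents `2N / (N + 2λ)` and `2N / (N - 2λ)`. -/
lemma norm_star_dotProduct_le_pNorm {d : ℕ} {N lam : ℝ} (hN : 0 < N) (hlam : 0 ≤ lam)
    (h : lam ≤ N / 2) {x : Fin d → ℂ} (hx : x ∈ pBall d (ballExp N lam)) (z : Fin d → ℂ) :
    ‖star x ⬝ᵥ z‖ ≤ pNorm (dualExp N lam) z := by
  refine (norm_star_dotProduct_le_sum x z).trans ?_
  rcases h.lt_or_eq with h | rfl
  · have hc := holderConjugate_dualExp hN hlam h
    rw [ballExp, mem_pBall_ofReal_iff hc.symm.pos] at hx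
    rw [dualExp_of_lt h, pNorm_ofReal hc.pos]
    refine (Real.inner_le_Lp_mul_Lq_of_nonneg Finset.univ hc (fun i _ => norm_nonneg (z i))
      (fun i _ => norm_nonneg (x i))).trans ?_
    refine mul_le_of_le_one_right (by positivity) (Real.rpow_le_one (by positivity) hx ?_)
    exact one_div_nonneg.mpr hc.symm.nonneg
  · rw [ballExp_half hN, mem_pBall_ofReal_iff one_pos] at hx
    simp only [Real.rpow_one] at hx
    rw [dualExp_half hN, pNorm, PiLp.norm_eq_ciSup]
    have hle : ∀ i, ‖z i‖ ≤ ⨆ i, ‖z i‖ := le_ciSup (Set.finite_range _).bddAbove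
    refine (Finset.sum_le_sum fun i _ =>
      mul_le_mul_of_nonneg_right (hle i) (norm_nonneg (x i))).trans ?_
    rw [← Finset.mul_sum]
    exact mul_le_of_le_one_right (Real.iSup_nonneg fun i => norm_nonneg _) hx

/-- Equality is attained in Hölder's inequality. -/
lemma exists_norm_star_dotProduct_eq_pNorm {d : ℕ} (hd : 1 ≤ d) {N lam : ℝ} (hN : 0 < N)
    (hlam : 0 ≤ lam) (h : lam ≤ N / 2) (z : Fin d → ℂ) :
    ∃ x ∈ pBall d (ballExp N lam), ‖star x ⬝ᵥ z‖ = pNorm (dualExp N lam) z := by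
  choose u hu huz using fun i => exists_phase (z i)
  rcases h.lt_or_eq with h | rfl
  · have hc := holderConjugate_dualExp hN hlam h
    -- The extremal moduli come from real `ℓᵖ` duality; multiplying by the phases of `z` makes all
    -- terms of the form nonnegative.
    obtain ⟨g, hg, hgz⟩ := (NNReal.isGreatest_Lp Finset.univ (fun i => ‖z i‖₊) hc).1
    have hg' : ∑ i, (g i : ℝ) ^ (2 * N / (N + 2 * lam)) ≤ 1 := by exact_mod_cast hg
    have hgz' : ∑ i, ‖z i‖ * (g i : ℝ) =
        (∑ i, ‖z i‖ ^ (2 * N / (N - 2 * lam))) ^ (1 / (2 * N / (N - 2 * lam))) := by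
      have := congrArg NNReal.toReal hgz
      push_cast at this
      simpa using this
    refine ⟨fun i => (g i : ℝ) * u i, ?_, ?_⟩
    · rw [ballExp, mem_pBall_ofReal_iff hc.symm.pos]
      simpa [hu] using hg'
    · rw [dualExp_of_lt h, pNorm_ofReal hc.pos, ← hgz']
      have : (star fun i => ((g i : ℝ) : ℂ) * u i) ⬝ᵥ z =
          ((∑ i, ‖z i‖ * (g i : ℝ) : ℝ) : ℂ) := by
        rw [dotProduct, Complex.ofReal_sum]
        refine Finset.sum_congr rfl fun i _ => ?_
        rw [Pi.star_apply, star_mul', mul_assoc, huz]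
        simp [mul_comm]
      rw [this, Complex.norm_real, Real.norm_of_nonneg (by positivity)]
  -- Here `r = 1` and `r' = ∞`: the extremal vector is a phase at a coordinate where `|z|` is
  -- maximal.
  · have : Nonempty (Fin d) := ⟨⟨0, hd⟩⟩
    obtain ⟨i, hi⟩ := exists_eq_ciSup_of_finite (f := fun i => ‖z i‖)
    refine ⟨Pi.single i (u i), ?_, ?_⟩
    · rw [ballExp_half hN, mem_pBall_ofReal_iff one_pos, Finset.sum_eq_single i]
      · simp [hu]
      · intro j _ hj
        simp [hj]
      · simp
    · rw [Pi.star_single, single_dotProduct, huz, dualExp_half hN, pNorm, PiLp.norm_eq_ciSup]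
      simpa using hi

lemma one_le_ballExp {N lam : ℝ} (hN : 0 < N) (hlam : 0 ≤ lam) (h : lam ≤ N / 2) :
    1 ≤ ballExp N lam := by
  rw [ballExp, ENNReal.one_le_ofReal, one_le_div (by positivity)]
  linarith

lemma one_le_dualExp {N lam : ℝ} (hN : 0 < N) (hlam : 0 ≤ lam) (h : lam ≤ N / 2) :
    1 ≤ dualExp N lam := by
  rcases h.lt_or_eq with h | rfl
  · rw [dualExp_of_lt h, ENNReal.one_le_ofReal]
    exact (holderConjugate_dualExp hN hlam h).lt.le
  · rw [dualExp_half hN]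
    exact le_top

lemma pNorm_smul {d : ℕ} {p : ENNReal} (hp : 1 ≤ p) (c : ℂ) (x : Fin d → ℂ) :
    pNorm p (c • x) = ‖c‖ * pNorm p x := by
  have : Fact (1 ≤ p) := ⟨hp⟩
  exact norm_smul c (WithLp.toLp p x : PiLp p fun _ : Fin d => ℂ)

lemma pNorm_pos {d : ℕ} {p : ENNReal} (hp : 1 ≤ p) {x : Fin d → ℂ} (hx : x ≠ 0) :
    0 < pNorm p x := by
  have : Fact (1 ≤ p) := ⟨hp⟩
  refine (norm_pos_iff (a := (WithLp.toLp p x : PiLp p fun _ : Fin d => ℂ))).mpr fun h => hx ?_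
  simpa using h

lemma pNorm_nonneg {d : ℕ} {p : ENNReal} (hp : 1 ≤ p) (x : Fin d → ℂ) : 0 ≤ pNorm p x := by
  have : Fact (1 ≤ p) := ⟨hp⟩
  exact norm_nonneg (WithLp.toLp p x : PiLp p fun _ : Fin d => ℂ)

lemma omega_eq_opNorm {d : ℕ} (hd : 1 ≤ d) (M : Matrix (Fin d) (Fin d) ℂ) {N lam mu : ℝ}
    (hN : 0 < N) (hlam : 0 ≤ lam) (hmu : 0 ≤ mu) (hlamN : lam ≤ N / 2) (hmuN : mu ≤ N / 2) :
    omega M N lam mu = opNorm M (ballExp N mu) (dualExp N lam) := by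
  have hs := one_le_ballExp hN hmu hmuN
  have hr := one_le_dualExp hN hlam hlamN
  have hsub : {t : ℝ | ∃ φ : Fin d → ℂ, φ ≠ 0 ∧
      t = pNorm (dualExp N lam) (M.mulVec φ) / pNorm (ballExp N mu) φ} ⊆
      omegaSet M (ballExp N lam) (ballExp N mu) := by
    rintro t ⟨φ, hφ, rfl⟩
    have hpos := pNorm_pos hs hφ
    have hc : ‖((pNorm (ballExp N mu) φ)⁻¹ : ℂ)‖ = (pNorm (ballExp N mu) φ)⁻¹ := by
      rw [norm_inv, Complex.norm_real, Real.norm_of_nonneg hpos.le]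
    obtain ⟨x, hx, hxy⟩ := exists_norm_star_dotProduct_eq_pNorm hd hN hlam hlamN
      (M.mulVec (((pNorm (ballExp N mu) φ)⁻¹ : ℂ) • φ))
    refine ⟨x, hx, ((pNorm (ballExp N mu) φ)⁻¹ : ℂ) • φ, ?_, ?_⟩
    · exact ((pNorm_smul hs ((pNorm (ballExp N mu) φ)⁻¹ : ℂ) φ).trans
        (by rw [hc, inv_mul_cancel₀ hpos.ne'])).le
    · rw [hxy, Matrix.mulVec_smul, pNorm_smul hr, hc, div_eq_inv_mul]
  have hbdd := bddAbove_omegaSet M hN hlam hmu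
  have hne : (Pi.single ⟨0, hd⟩ 1 : Fin d → ℂ) ≠ 0 := by simp
  have hmem : pNorm (dualExp N lam) (M.mulVec (Pi.single ⟨0, hd⟩ 1)) /
      pNorm (ballExp N mu) (Pi.single ⟨0, hd⟩ 1) ∈ {t : ℝ | ∃ φ : Fin d → ℂ, φ ≠ 0 ∧
      t = pNorm (dualExp N lam) (M.mulVec φ) / pNorm (ballExp N mu) φ} := ⟨_, hne, rfl⟩
  refine le_antisymm (csSup_le ⟨_, hsub hmem⟩ ?_) (csSup_le_csSup hbdd ⟨_, hmem⟩ hsub)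
  rintro t ⟨x, hx, y, hy, rfl⟩
  -- The ratios exclude `φ = 0`; for `y = 0` the form is `0`, which any ratio dominates.
  by_cases hy0 : y = 0
  · rw [hy0, Matrix.mulVec_zero, dotProduct_zero, norm_zero]
    exact (div_nonneg (pNorm_nonneg hr _) (pNorm_nonneg hs _)).trans
      (le_csSup (hbdd.mono hsub) hmem)
  · refine le_trans ?_ (le_csSup (hbdd.mono hsub) ⟨y, hy0, rfl⟩)
    exact (norm_star_dotProduct_le_pNorm hN hlam hlamN hx _).trans
      (le_div_self (pNorm_nonneg hr _) (pNorm_pos hs hy0) hy)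

lemma omega_conjTranspose {d : ℕ} (M : Matrix (Fin d) (Fin d) ℂ) (N lam mu : ℝ) :
    omega M.conjTranspose N mu lam = omega M N lam mu := by
  have h : ∀ x y : Fin d → ℂ,
      ‖star y ⬝ᵥ M.conjTranspose.mulVec x‖ = ‖star x ⬝ᵥ M.mulVec y‖ := fun x y => by
    rw [Matrix.star_dotProduct, norm_star, Matrix.star_mulVec, Matrix.conjTranspose_conjTranspose,
      ← Matrix.dotProduct_mulVec]
  unfold omega omegaSet
  congr 1
  ext t
  constructor
  · rintro ⟨y, hy, x, hx, rfl⟩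
    exact ⟨x, hx, y, hy, h x y⟩
  · rintro ⟨x, hx, y, hy, rfl⟩
    exact ⟨y, hy, x, hx, (h x y).symm⟩

/-! ### Asymptotics for large `N` -/

open Filter Topology

/-- Vectors of the unit ball are parametrized by the Euclidean unit ball. -/
lemma exists_vec_of_mem_pBall {d : ℕ} {N lam : ℝ} (hN : 0 < N) (hlam : 0 ≤ lam) {x : Fin d → ℂ}
    (hx : x ∈ pBall d (ballExp N lam)) :
    ∃ a : Fin d → ℂ, ∑ i, ‖a i‖ ^ 2 ≤ 1 ∧
      ∀ i, x i = a i * Real.exp (2 * lam / N * Real.log ‖a i‖) := by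
  rw [ballExp, mem_pBall_ofReal_iff (ballExp_pos hN hlam)] at hx
  have hNl : 0 < N + 2 * lam := by positivity
  set r := 2 * N / (N + 2 * lam) with hr
  have hnorm : ∀ i, x i ≠ 0 → ‖x i * Real.exp ((r / 2 - 1) * Real.log ‖x i‖)‖ =
      Real.exp (r / 2 * Real.log ‖x i‖) := fun i hi => by
    rw [norm_mul, Complex.norm_real, Real.norm_of_nonneg (Real.exp_nonneg _)]
    conv_lhs => rw [← Real.exp_log (norm_pos_iff.mpr hi)]
    rw [Real.log_exp, ← Real.exp_add]
    congr 1
    ring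
  -- This inverts `a ↦ a|a|^(2λ/N)`: it makes `|a| = |x|^(r/2)`, and `(r/2 - 1) + (2λ/N)(r/2) = 0`.
  refine ⟨fun i => x i * Real.exp ((r / 2 - 1) * Real.log ‖x i‖), ?_, fun i => ?_⟩
  · refine (Finset.sum_le_sum fun i _ => ?_).trans hx
    by_cases hi : x i = 0
    · simp only [hi, zero_mul, norm_zero, ne_eq, OfNat.ofNat_ne_zero, not_false_eq_true, zero_pow]
      positivity
    · rw [hnorm i hi, ← Real.exp_nat_mul, Real.rpow_def_of_pos (norm_pos_iff.mpr hi)]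
      refine le_of_eq (congrArg _ ?_)
      push_cast
      ring
  · by_cases hi : x i = 0
    · simp [hi]
    · simp only
      rw [hnorm i hi, Real.log_exp, mul_assoc, ← Complex.ofReal_mul, ← Real.exp_add]
      have : (r / 2 - 1) * Real.log ‖x i‖ + 2 * lam / N * (r / 2 * Real.log ‖x i‖) = 0 := by
        rw [hr]
        field_simp
        ring
      rw [this, Real.exp_zero, Complex.ofReal_one, mul_one]

/-- Follows from `exp(-u) ≥ 1 - u + u²/2` and `(1 - u + u²/2)(1 + u + u²/2) = 1 + u⁴/4 ≥ 1`. -/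
lemma exp_le_quadratic_of_nonpos {u : ℝ} (hu : u ≤ 0) : Real.exp u ≤ 1 + u + u ^ 2 / 2 := by
  have h := Real.quadratic_le_exp_of_nonneg (neg_nonneg.mpr hu)
  have hpos := Real.exp_pos u
  have h1 : Real.exp u * Real.exp (-u) = 1 := by rw [← Real.exp_add, add_neg_cancel, Real.exp_zero]
  have h2 : Real.exp u * (1 + -u + (-u) ^ 2 / 2) ≤ 1 :=
    (mul_le_mul_of_nonneg_left h hpos.le).trans h1.le
  have h3 : 0 < 1 + -u + (-u) ^ 2 / 2 := by nlinarith
  by_contra! hc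
  have h4 := mul_lt_mul_of_pos_right hc h3
  nlinarith [sq_nonneg (u ^ 2)]

lemma mul_log_sq_le {p : ℝ} (h0 : 0 ≤ p) (h1 : p ≤ 1) : p * Real.log p ^ 2 ≤ 4 := by
  rcases h0.eq_or_lt with rfl | h0
  · simp
  · have h := Real.abs_log_mul_self_rpow_lt p (1 / 2) h0 h1 (by norm_num)
    have h2 : (Real.log p * p ^ (1 / 2 : ℝ)) ^ 2 = p * Real.log p ^ 2 := by
      rw [mul_pow, ← Real.sqrt_eq_rpow, Real.sq_sqrt h0.le, mul_comm]
    rw [← h2, ← sq_abs]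
    have h3 := abs_nonneg (Real.log p * p ^ (1 / 2 : ℝ))
    rw [one_div_one_div] at h
    nlinarith

/-- The Euclidean norm of a vector in the unit ball of exponent below `2` is controlled by the
entropy. -/
lemma sum_norm_sq_mul_exp_le {d : ℕ} {τ : ℝ} (hτ : 0 ≤ τ) {a : Fin d → ℂ}
    (ha : ∑ i, ‖a i‖ ^ 2 ≤ 1) :
    ∑ i, ‖a i * Real.exp (2 * τ * Real.log ‖a i‖)‖ ^ 2 ≤
      Real.exp (2 * (-(τ * vecEntropy a) + 4 * d * τ ^ 2)) := by
  have hterm : ∀ i, ‖a i * Real.exp (2 * τ * Real.log ‖a i‖)‖ ^ 2 ≤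
      ‖a i‖ ^ 2 - 2 * τ * Real.negMulLog (‖a i‖ ^ 2) + 8 * τ ^ 2 := fun i => by
    have h1 := norm_sq_le_one_of_sum_le_one ha i
    have hlog : Real.log (‖a i‖ ^ 2) = 2 * Real.log ‖a i‖ := by
      rw [Real.log_pow]
      norm_num
    have he : ‖a i * Real.exp (2 * τ * Real.log ‖a i‖)‖ ^ 2 =
        ‖a i‖ ^ 2 * Real.exp (2 * τ * Real.log (‖a i‖ ^ 2)) := by
      rw [norm_mul, mul_pow, Complex.norm_real, Real.norm_of_nonneg (Real.exp_nonneg _),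
        ← Real.exp_nat_mul, hlog]
      congr 2
      push_cast
      ring
    rw [he]
    set p := ‖a i‖ ^ 2 with hp
    have h0 : 0 ≤ p := sq_nonneg _
    have hq := mul_log_sq_le h0 h1
    have hexp := mul_le_mul_of_nonneg_left (exp_le_quadratic_of_nonpos
      (mul_nonpos_of_nonneg_of_nonpos (by positivity : 0 ≤ 2 * τ) (Real.log_nonpos h0 h1))) h0
    refine hexp.trans ?_
    rw [Real.negMulLog]
    -- The quadratic term is `p (2τ log p)² / 2 = 2τ² p (log p)² ≤ 8τ²`.
    nlinarith [mul_le_mul_of_nonneg_left hq (sq_nonneg τ)]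
  refine (Finset.sum_le_sum fun i _ => hterm i).trans ?_
  rw [Finset.sum_add_distrib, Finset.sum_sub_distrib, ← Finset.mul_sum, Finset.sum_const,
    Finset.card_univ, Fintype.card_fin, nsmul_eq_mul]
  refine le_trans ?_ (Real.add_one_le_exp _)
  rw [vecEntropy]
  linarith

/-- The difference is at most `τ |u| |log |u||`, and `|u| |log |u|| < 1` for `0 < |u| ≤ 1`. The
bound is uniform in `u`, so `x` and `a` share their limits. -/
lemma norm_mul_exp_sub_le {τ : ℝ} (hτ : 0 ≤ τ) {u : ℂ} (hu : ‖u‖ ≤ 1) :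
    ‖u * Real.exp (τ * Real.log ‖u‖) - u‖ ≤ τ := by
  rcases (norm_nonneg u).eq_or_lt with h0 | h0
  · rw [norm_eq_zero.mp h0.symm]
    simpa using hτ
  · have hlog := Real.log_nonpos (norm_nonneg u) hu
    have hneg : τ * Real.log ‖u‖ ≤ 0 := mul_nonpos_of_nonneg_of_nonpos hτ hlog
    have h1 : u * Real.exp (τ * Real.log ‖u‖) - u =
        u * ((Real.exp (τ * Real.log ‖u‖) - 1 : ℝ) : ℂ) := by
      push_cast
      ring
    rw [h1, norm_mul, Complex.norm_real, Real.norm_eq_abs,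
      abs_of_nonpos (by linarith [Real.exp_le_one_iff.mpr hneg])]
    have h2 := Real.add_one_le_exp (τ * Real.log ‖u‖)
    have h3 := Real.abs_log_mul_self_lt ‖u‖ h0 hu
    rw [abs_of_nonpos (mul_nonpos_of_nonpos_of_nonneg hlog h0.le)] at h3
    nlinarith [mul_le_mul_of_nonneg_left h2 h0.le, mul_le_mul_of_nonneg_left h3.le hτ]

lemma norm_form_le_exp {d : ℕ} {M : Matrix (Fin d) (Fin d) ℂ}
    (hM : M ∈ Matrix.unitaryGroup (Fin d) ℂ) {σ τ : ℝ} (hσ : 0 ≤ σ) (hτ : 0 ≤ τ)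
    {a b x y : Fin d → ℂ} (ha : ∑ i, ‖a i‖ ^ 2 ≤ 1) (hb : ∑ i, ‖b i‖ ^ 2 ≤ 1)
    (hx : ∀ i, x i = a i * Real.exp (2 * σ * Real.log ‖a i‖))
    (hy : ∀ i, y i = b i * Real.exp (2 * τ * Real.log ‖b i‖)) :
    ‖star x ⬝ᵥ M.mulVec y‖ ≤
      Real.exp (-(σ * vecEntropy a + τ * vecEntropy b) + 4 * d * (σ ^ 2 + τ ^ 2)) := by
  have key : ∀ {c z : Fin d → ℂ} {κ : ℝ}, 0 ≤ κ → ∑ i, ‖c i‖ ^ 2 ≤ 1 →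
      (∀ i, z i = c i * Real.exp (2 * κ * Real.log ‖c i‖)) →
      √(∑ i, ‖z i‖ ^ 2) ≤ Real.exp (-(κ * vecEntropy c) + 4 * d * κ ^ 2) := by
    intro c z κ hκ hc hz
    rw [Real.sqrt_le_left (Real.exp_nonneg _), ← Real.exp_nat_mul]
    simp only [hz]
    exact_mod_cast sum_norm_sq_mul_exp_le hκ hc
  refine (norm_form_le_sqrt_mul_sqrt hM x y).trans
    ((mul_le_mul (key hσ ha hx) (key hτ hb hy) (Real.sqrt_nonneg _) (Real.exp_nonneg _)).trans ?_)
  rw [← Real.exp_add]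
  exact Real.exp_le_exp.mpr (by linarith)

/-- Equality in the Cauchy-Schwarz inequality for the form of a unitary matrix. -/
lemma eq_smul_mulVec_of_one_le_norm_form {d : ℕ} {M : Matrix (Fin d) (Fin d) ℂ}
    (hM : M ∈ Matrix.unitaryGroup (Fin d) ℂ) {a b : Fin d → ℂ} (ha : ∑ i, ‖a i‖ ^ 2 ≤ 1)
    (hb : ∑ i, ‖b i‖ ^ 2 ≤ 1) (hab : 1 ≤ ‖star a ⬝ᵥ M.mulVec b‖) :
    ∑ i, ‖b i‖ ^ 2 = 1 ∧ ∃ z : ℂ, ‖z‖ = 1 ∧ a = z • M.mulVec b := by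
  have hle := hab.trans (norm_form_le_sqrt_mul_sqrt hM a b)
  have ha1 := Real.sqrt_le_one.mpr ha
  have hb1 := Real.sqrt_le_one.mpr hb
  constructor
  · refine le_antisymm hb ?_
    rw [← Real.one_le_sqrt]
    nlinarith [Real.sqrt_nonneg (∑ i, ‖b i‖ ^ 2)]
  · obtain ⟨u, hu, huz⟩ := exists_phase (star a ⬝ᵥ M.mulVec b)
    refine ⟨star u, by rw [norm_star, hu], ?_⟩
    -- With the phase chosen to make the cross term real, the square expands to at most `1 - 2 |a† M
    -- b| + 1 ≤ 0`.
    have h : ‖(WithLp.toLp 2 a : EuclideanSpace ℂ (Fin d)) - WithLp.toLp 2 (star u • M.mulVec b)‖ ^ 2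
        ≤ 0 := by
      rw [norm_sub_sq (𝕜 := ℂ), EuclideanSpace.inner_toLp_toLp, EuclideanSpace.norm_sq_eq,
        EuclideanSpace.norm_sq_eq, dotProduct_comm, dotProduct_smul, smul_eq_mul, huz]
      simp only [Pi.smul_apply, smul_eq_mul, norm_mul, norm_star, hu, one_mul,
        sum_norm_sq_mulVec hM, RCLike.re_to_complex, Complex.ofReal_re]
      linarith
    have h0 := sub_eq_zero.mp (norm_eq_zero.mp (pow_eq_zero_iff two_ne_zero |>.mp
      (le_antisymm h (sq_nonneg _))))
    exact WithLp.toLp_injective 2 h0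

lemma isCompact_sum_norm_sq_le_one (d : ℕ) :
    IsCompact {a : Fin d → ℂ | ∑ i, ‖a i‖ ^ 2 ≤ 1} := by
  refine Metric.isCompact_of_isClosed_isBounded (isClosed_le (by fun_prop) continuous_const) ?_
  refine (Metric.isBounded_closedBall (x := (0 : Fin d → ℂ)) (r := 1)).subset fun a ha => ?_
  rw [mem_closedBall_zero_iff, pi_norm_le_iff_of_nonneg zero_le_one]
  exact fun i => (sq_le_one_iff₀ (norm_nonneg _)).mp (norm_sq_le_one_of_sum_le_one ha i)

lemma tendsto_mul_exp_log {d : ℕ} {F : Filter ℝ} (hF : F ≤ atTop) {κ : ℝ} (hκ : 0 ≤ κ)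
    {c w : ℝ → Fin d → ℂ} {c₀ : Fin d → ℂ} (hc : Tendsto c F (𝓝 c₀))
    (hw : ∀ᶠ N in F, 0 < N ∧ ∑ i, ‖c N i‖ ^ 2 ≤ 1 ∧
      ∀ i, w N i = c N i * Real.exp (2 * (κ / N) * Real.log ‖c N i‖)) :
    Tendsto w F (𝓝 c₀) := by
  have hinv : Tendsto (fun N : ℝ => κ / N) F (𝓝 0) :=
    (tendsto_const_nhds.div_atTop tendsto_id).mono_left hF
  have hdiff : Tendsto (fun N => w N - c N) F (𝓝 0) := by
    refine squeeze_zero_norm' (a := fun N => 2 * (κ / N)) ?_ (by simpa using hinv.const_mul 2)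
    filter_upwards [hw] with N ⟨hN, hcN, hwN⟩
    have hκN : 0 ≤ 2 * (κ / N) := by positivity
    rw [pi_norm_le_iff_of_nonneg hκN]
    intro i
    rw [Pi.sub_apply, hwN]
    exact norm_mul_exp_sub_le hκN
      ((sq_le_one_iff₀ (norm_nonneg _)).mp (norm_sq_le_one_of_sum_le_one hcN i))
  simpa using hdiff.add hc

lemma tendsto_norm_form {d : ℕ} (M : Matrix (Fin d) (Fin d) ℂ) {ι : Type*} {F : Filter ι}
    {x y : ι → Fin d → ℂ} {a b : Fin d → ℂ} (hx : Tendsto x F (𝓝 a)) (hy : Tendsto y F (𝓝 b)) :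
    Tendsto (fun k => ‖star (x k) ⬝ᵥ M.mulVec (y k)‖) F (𝓝 ‖star a ⬝ᵥ M.mulVec b‖) := by
  refine Tendsto.norm (tendsto_finsetSum _ fun i _ => ?_)
  have hM : Tendsto (fun k => ∑ j, M i j * y k j) F (𝓝 (∑ j, M i j * b j)) :=
    tendsto_finsetSum _ fun j _ => tendsto_const_nhds.mul (tendsto_pi_nhds.mp hy j)
  exact ((tendsto_pi_nhds.mp hx i).star).mul hM

/-- Near-maximizers of the form, parametrized by the Euclidean unit ball. -/
lemma exists_exp_lt_norm_form {d : ℕ} (hd : 1 ≤ d) {M : Matrix (Fin d) (Fin d) ℂ}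
    (hM : M ∈ Matrix.unitaryGroup (Fin d) ℂ) {N lam mu K : ℝ} (hN : 0 < N) (hlam : 0 ≤ lam)
    (hmu : 0 ≤ mu) (hlt : -N * Real.log (omega M N lam mu) < K) :
    ∃ a b x y : Fin d → ℂ, ∑ i, ‖a i‖ ^ 2 ≤ 1 ∧ ∑ i, ‖b i‖ ^ 2 ≤ 1 ∧
      (∀ i, x i = a i * Real.exp (2 * (lam / N) * Real.log ‖a i‖)) ∧
      (∀ i, y i = b i * Real.exp (2 * (mu / N) * Real.log ‖b i‖)) ∧
      Real.exp (-K / N) < ‖star x ⬝ᵥ M.mulVec y‖ := by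
  have hω := omega_pos hd hM hN hlam hmu
  have h1 : Real.exp (-K / N) < omega M N lam mu := by
    rw [← Real.lt_log_iff_exp_lt hω, div_lt_iff₀ hN]
    linarith
  have hne : (omegaSet M (ballExp N lam) (ballExp N mu)).Nonempty := by
    by_contra! h
    rw [omega, h, Real.sSup_empty] at hω
    exact lt_irrefl _ hω
  obtain ⟨t, ⟨x, hx, y, hy, rfl⟩, ht⟩ := exists_lt_of_lt_csSup hne h1
  obtain ⟨a, ha, hax⟩ := exists_vec_of_mem_pBall hN hlam hx
  obtain ⟨b, hb, hby⟩ := exists_vec_of_mem_pBall hN hmu hy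
  exact ⟨a, b, x, y, ha, hb, by simpa only [mul_div_assoc] using hax,
    by simpa only [mul_div_assoc] using hby, ht⟩

/-- If `M` is unitary and `-N log ω_N ≤ K` for arbitrarily large `N`, then some unit vector has
weighted entropy at most `K`. -/
lemma exists_vec_of_frequently_le {d : ℕ} (hd : 1 ≤ d) {M : Matrix (Fin d) (Fin d) ℂ}
    (hM : M ∈ Matrix.unitaryGroup (Fin d) ℂ) {lam mu K : ℝ} (hlam : 0 ≤ lam) (hmu : 0 ≤ mu)
    (hK : ∃ᶠ N : ℝ in atTop, -N * Real.log (omega M N lam mu) < K) :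
    ∃ b : Fin d → ℂ, ∑ i, ‖b i‖ ^ 2 = 1 ∧
      lam * vecEntropy (M.mulVec b) + mu * vecEntropy b ≤ K := by
  have hK' : ∃ᶠ N : ℝ in atTop, 0 < N ∧ -N * Real.log (omega M N lam mu) < K :=
    (hK.and_eventually (eventually_gt_atTop 0)).mono fun N h => ⟨h.2, h.1⟩
  have hex : ∀ N : ℝ, ∃ a b x y : Fin d → ℂ, (0 < N ∧ -N * Real.log (omega M N lam mu) < K) →
      ∑ i, ‖a i‖ ^ 2 ≤ 1 ∧ ∑ i, ‖b i‖ ^ 2 ≤ 1 ∧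
      (∀ i, x i = a i * Real.exp (2 * (lam / N) * Real.log ‖a i‖)) ∧
      (∀ i, y i = b i * Real.exp (2 * (mu / N) * Real.log ‖b i‖)) ∧
      Real.exp (-K / N) < ‖star x ⬝ᵥ M.mulVec y‖ := by
    intro N
    by_cases hN : 0 < N ∧ -N * Real.log (omega M N lam mu) < K
    · obtain ⟨a, b, x, y, h⟩ := exists_exp_lt_norm_form hd hM hN.1 hlam hmu hN.2
      exact ⟨a, b, x, y, fun _ => h⟩
    · exact ⟨0, 0, 0, 0, fun h => absurd h hN⟩
  choose a b x y hprop using hex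
  have hne : (atTop ⊓ 𝓟 {N : ℝ | 0 < N ∧ -N * Real.log (omega M N lam mu) < K}).NeBot :=
    frequently_mem_iff_neBot.mp hK'
  -- Along an ultrafilter concentrated on the good `N`, every family in a compact set converges, so
  -- no subsequences are needed.
  obtain ⟨F, hFtop, hF⟩ : ∃ F : Ultrafilter ℝ, (F : Filter ℝ) ≤ atTop ∧
      ∀ᶠ N in (F : Filter ℝ), 0 < N ∧ -N * Real.log (omega M N lam mu) < K :=
    ⟨Ultrafilter.of _, (Ultrafilter.of_le _).trans inf_le_left,
      (Ultrafilter.of_le _).trans inf_le_right (mem_principal_self _)⟩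
  have hlim : ∀ c : ℝ → Fin d → ℂ, (∀ᶠ N in (F : Filter ℝ), ∑ i, ‖c N i‖ ^ 2 ≤ 1) →
      ∃ c₀ : Fin d → ℂ, ∑ i, ‖c₀ i‖ ^ 2 ≤ 1 ∧ Tendsto c F (𝓝 c₀) := fun c hc =>
    (isCompact_sum_norm_sq_le_one d).ultrafilter_le_nhds (F.map c)
      (le_principal_iff.mpr hc)
  obtain ⟨a₀, ha₀, hta⟩ := hlim a (hF.mono fun N hN => (hprop N hN).1)
  obtain ⟨b₀, hb₀, htb⟩ := hlim b (hF.mono fun N hN => (hprop N hN).2.1)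
  have hinv : ∀ κ : ℝ, Tendsto (fun N : ℝ => κ / N) F (𝓝 0) := fun κ =>
    (tendsto_const_nhds.div_atTop tendsto_id).mono_left hFtop
  have htx : Tendsto x F (𝓝 a₀) := by
    refine tendsto_mul_exp_log hFtop hlam hta ?_
    filter_upwards [hF] with N hN
    exact ⟨hN.1, (hprop N hN).1, (hprop N hN).2.2.1⟩
  have hty : Tendsto y F (𝓝 b₀) := by
    refine tendsto_mul_exp_log hFtop hmu htb ?_
    filter_upwards [hF] with N hN
    exact ⟨hN.1, (hprop N hN).2.1, (hprop N hN).2.2.2.1⟩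
  have hform := tendsto_norm_form M htx hty
  have hone : 1 ≤ ‖star a₀ ⬝ᵥ M.mulVec b₀‖ := by
    have h1 : Tendsto (fun N : ℝ => Real.exp (-K / N)) F (𝓝 1) := by
      simpa using (hinv (-K)).rexp
    exact le_of_tendsto_of_tendsto h1 hform (hF.mono fun N hN => (hprop N hN).2.2.2.2.le)
  obtain ⟨hb1, z, hz, haz⟩ := eq_smul_mulVec_of_one_le_norm_form hM ha₀ hb₀ hone
  refine ⟨b₀, hb1, ?_⟩
  have hent : Tendsto (fun N => lam * vecEntropy (a N) + mu * vecEntropy (b N)) F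
      (𝓝 (lam * vecEntropy a₀ + mu * vecEntropy b₀)) :=
    (((continuous_vecEntropy.tendsto _).comp hta).const_mul lam).add
      (((continuous_vecEntropy.tendsto _).comp htb).const_mul mu)
  have hbound : Tendsto (fun N : ℝ => K + 4 * d * (lam ^ 2 + mu ^ 2) / N) F (𝓝 K) := by
    simpa using (hinv (4 * d * (lam ^ 2 + mu ^ 2))).const_add K
  rw [haz, vecEntropy_smul hz] at hent
  refine le_of_tendsto_of_tendsto hent hbound ?_
  filter_upwards [hF] with N hN
  obtain ⟨h1, h2, h3, h4, h5⟩ := hprop N hN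
  have hN0 := hN.1
  -- Comparing exponents and multiplying by `N` turns the `1/N²` error into `O(1/N)`, which vanishes
  -- in the limit.
  have h6 := Real.exp_lt_exp.mp (h5.trans_le (norm_form_le_exp hM (by positivity) (by positivity)
    h1 h2 h3 h4))
  have h7 := mul_lt_mul_of_pos_left h6 hN0
  have e1 : N * (-K / N) = -K := by field_simp
  have e2 : N * (-(lam / N * vecEntropy (a N) + mu / N * vecEntropy (b N)) +
      4 * d * ((lam / N) ^ 2 + (mu / N) ^ 2)) =
      -(lam * vecEntropy (a N) + mu * vecEntropy (b N)) + 4 * d * (lam ^ 2 + mu ^ 2) / N := by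
    field_simp
  rw [e1, e2] at h7
  linarith

end EntropicUncertainty

/-! ### The theorem -/

open EntropicUncertainty

theorem theorem1 {d : ℕ} (hd : 1 ≤ d)
    {H : Type*} [NormedAddCommGroup H] [InnerProductSpace ℂ H]
    (e : OrthonormalBasis (Fin d) ℂ H) (U : H ≃ₗᵢ[ℂ] H)
    (lam mu : ℝ) (hlam : 0 ≤ lam) (hmu : 0 ≤ mu) :
    (∀ N : ℝ, 1 ≤ N →
      -N * Real.log (omega (basisMatrix e U) N lam mu) ≤ optConst e U lam mu) ∧
    (∀ N : ℝ, 1 ≤ N → lam ≤ N / 2 → mu ≤ N / 2 →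
      omega (basisMatrix e U) N lam mu
          = opNorm (basisMatrix e U) (ballExp N mu) (dualExp N lam) ∧
      omega (basisMatrix e U) N lam mu
          = opNorm (basisMatrix e U).conjTranspose (ballExp N lam) (dualExp N mu)) ∧
    (0 < lam → 0 < mu →
      Filter.Tendsto (fun N : ℝ => -N * Real.log (omega (basisMatrix e U) N lam mu))
        Filter.atTop (nhds (optConst e U lam mu))) := by
  have hM := basisMatrix_mem_unitaryGroup e U
  have hlower : ∀ N : ℝ, 1 ≤ N →
      -N * Real.log (omega (basisMatrix e U) N lam mu) ≤ optConst e U lam mu := fun N hN =>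
    le_optConst e U hd hlam hmu fun b hb =>
      neg_mul_log_omega_le_vec hd hM (by linarith) hlam hmu hb
  refine ⟨hlower, fun N hN h1 h2 => ?_, fun _ _ => ?_⟩
  · have hN0 : 0 < N := by linarith
    refine ⟨omega_eq_opNorm hd _ hN0 hlam hmu h1 h2, ?_⟩
    rw [← omega_conjTranspose]
    exact omega_eq_opNorm hd _ hN0 hmu hlam h2 h1
  · rw [tendsto_order]
    constructor
    · intro K hK
      by_contra hnot
      -- The compactness argument needs strict bounds `< K'` and returns only `≤ K'`; a `K'`
      -- strictly between leaves room on both sides.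
      obtain ⟨K', hK1, hK2⟩ := exists_between hK
      obtain ⟨b, hb, hbK⟩ := exists_vec_of_frequently_le hd hM (K := K') hlam hmu
        ((Filter.not_eventually.mp hnot).mono fun N hN => (not_lt.mp hN).trans_lt hK1)
      exact absurd ((optConst_le e U hlam hmu b hb).trans hbK) (not_le.mpr hK2)
    · intro K hK
      filter_upwards [Filter.eventually_ge_atTop (1 : ℝ)] with N hN
      exact (hlower N hN).trans_lt hK
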